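/- Consider the following two elements of $\mathrm{SL}_3(\mathbb{Z}[t,t^{-1}])$: $$f=\begin{pmatrix} t&0&0\\0&1&0\\0&0&t^{-1}\end{pmatrix},\qquad k=\begin{pmatrix}0&-1-t&-t^{-1}-1-t\\0&t^{-1}+1+t&t^{-2}+t^{-1}+1+t\\1&0&0\end{pmatrix}.$$ For all integers $m,n\ge 3$, the elements $f^m$ and $k^n$ generate a free group of rank $2$; more precisely, the subgroup $\langle f^m,k^n\rangle$ of $\mathrm{SL}_3(\mathbb{Z}[t,t^{-1}])$ is free with free basis $(f^m,k^n)$. -/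

import Mathlib

open scoped LaurentPolynomial

/-- The matrix `f = diag(t, 1, t⁻¹)` over `ℤ[t, t⁻¹]`; `T j` is the monomial `t ^ j`. -/
noncomputable def burauFMatrix : Matrix (Fin 3) (Fin 3) ℤ[T;T⁻¹] :=
  open LaurentPolynomial in
  Matrix.diagonal ![T 1, 1, T (-1)]

/-- The matrix `k` over `ℤ[t, t⁻¹]`. -/
noncomputable def burauKMatrix : Matrix (Fin 3) (Fin 3) ℤ[T;T⁻¹] :=
  open LaurentPolynomial in
  !![0, -1 - T 1, -T (-1) - 1 - T 1;
     0, T (-1) + 1 + T 1, T (-2) + T (-1) + 1 + T 1;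
     1, 0, 0]

theorem burauFMatrix_det : burauFMatrix.det = 1 := by
  rw [burauFMatrix, Matrix.det_diagonal, Fin.prod_univ_three]
  simp only [Matrix.cons_val, mul_one]
  rw [← LaurentPolynomial.T_add]
  simp

theorem burauKMatrix_det : burauKMatrix.det = 1 := by
  have h1 : (LaurentPolynomial.T 1 * LaurentPolynomial.T (-1) : ℤ[T;T⁻¹]) = 1 := by
    rw [← LaurentPolynomial.T_add]; simp
  have h2 : (LaurentPolynomial.T (-2) : ℤ[T;T⁻¹])
      = LaurentPolynomial.T (-1) * LaurentPolynomial.T (-1) := by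
    rw [← LaurentPolynomial.T_add]; norm_num
  simp only [burauKMatrix, Matrix.det_fin_three, Matrix.of_apply, Matrix.cons_val]
  rw [h2]
  linear_combination (1 - LaurentPolynomial.T (-1)) * h1

/-- `f` as an element of `SL₃(ℤ[t, t⁻¹])`. -/
noncomputable def burauF : Matrix.SpecialLinearGroup (Fin 3) ℤ[T;T⁻¹] :=
  ⟨burauFMatrix, burauFMatrix_det⟩

/-- `k` as an element of `SL₃(ℤ[t, t⁻¹])`. -/
noncomputable def burauK : Matrix.SpecialLinearGroup (Fin 3) ℤ[T;T⁻¹] :=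
  ⟨burauKMatrix, burauKMatrix_det⟩

/-! Freeness can be tested after specializing `t` to an element of norm 2 in an ultrametric field.
There `f` and `k` are both diagonalizable with eigenvalues `t`, `1`, `t⁻¹`, and they play ping-pong
on vectors whose first or last coordinate dominates in the respective eigenbasis. Each change of
basis sends a vector of one set to one whose coordinate norms are known exactly
(`norm_kCoord_of_fst`, `norm_kComb_of_fst` and their `_of_last` analogues). A nonzero power of `f ^
m` or `k ^ n` then scales the outer coordinates by reciprocal factors, one of norm at least 8, which
suffices to restore dominance. -/

/-- Ping-pong for free generators of infinite order, with one set for each generator. -/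
theorem FreeGroup.injective_lift_of_zpow_ping_pong {ι G α : Type*} [Nontrivial ι] [Group G]
    [MulAction G α] (a : ι → G) (X : ι → Set α) (hne : ∀ i, (X i).Nonempty)
    (hdisj : Pairwise (Function.onFun Disjoint X))
    (hpp : ∀ i j, i ≠ j → ∀ z : ℤ, z ≠ 0 → ∀ x ∈ X j, (a i ^ z) • x ∈ X i) :
    Function.Injective (FreeGroup.lift a) := by
  have hfac : FreeGroup.lift a =
      (Monoid.CoprodI.lift fun i => FreeGroup.lift fun _ : Unit => a i).comp
        (@freeGroupEquivCoprodI ι).toMonoidHom := by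
    ext i
    simp
  rw [hfac, MonoidHom.coe_comp]
  refine Function.Injective.comp ?_ (MulEquiv.injective freeGroupEquivCoprodI)
  refine Monoid.CoprodI.lift_injective_of_ping_pong
    (fun i => FreeGroup.lift fun _ : Unit => a i) ?_ X hne hdisj ?_
  · inhabit ι
    -- Ping-pong for free products fails for two factors of order two; an infinite factor rules that
    -- out.
    refine Or.inr ⟨default, ?_⟩
    rw [FreeGroup.freeGroupUnitEquivInt.cardinal_eq, Cardinal.mk_denumerable]
    exact Cardinal.natCast_le_aleph0 (n := 3)
  · intro i j hij h hh
    obtain ⟨z, rfl⟩ := FreeGroup.freeGroupUnitEquivInt.symm.surjective h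
    have hz : z ≠ 0 := by
      rintro rfl
      exact hh (by simp [FreeGroup.freeGroupUnitEquivInt])
    rintro _ ⟨x, hx, rfl⟩
    simpa [FreeGroup.freeGroupUnitEquivInt] using hpp i j hij z hz x hx

/-- A family of group elements whose lift to the free group is injective is a free basis of the
subgroup it generates. -/
theorem FreeGroupBasis.exists_closure_range {ι G : Type*} [Group G] (a : ι → G)
    (h : Function.Injective (FreeGroup.lift a)) :
    ∃ b : FreeGroupBasis ι (Subgroup.closure (Set.range a)), ∀ i, (b i : G) = a i := by
  rw [← FreeGroup.range_lift_eq_closure]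
  refine ⟨⟨(MonoidHom.ofInjective h).symm⟩, fun i => ?_⟩
  change FreeGroup.lift a (FreeGroup.of i) = a i
  exact FreeGroup.lift_apply_of

theorem two_zpow_bounds {z : ℤ} (hz : 3 ≤ |z|) :
    (8 ≤ (2 : ℝ) ^ z ∧ 0 < (2 : ℝ) ^ (-z) ∧ (2 : ℝ) ^ (-z) ≤ 1 / 8) ∨
      (8 ≤ (2 : ℝ) ^ (-z) ∧ 0 < (2 : ℝ) ^ z ∧ (2 : ℝ) ^ z ≤ 1 / 8) := by
  have key : ∀ y : ℤ, 3 ≤ y →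
      8 ≤ (2 : ℝ) ^ y ∧ 0 < (2 : ℝ) ^ (-y) ∧ (2 : ℝ) ^ (-y) ≤ 1 / 8 := by
    intro y hy
    have h : (8 : ℝ) ≤ 2 ^ y :=
      calc (8 : ℝ) = 2 ^ (3 : ℤ) := by norm_num
        _ ≤ 2 ^ y := zpow_le_zpow_right₀ one_le_two hy
    refine ⟨h, by positivity, ?_⟩
    rw [zpow_neg, ← one_div]
    exact one_div_le_one_div_of_le (by norm_num) h
  rcases le_abs.mp hz with h | h
  · exact Or.inl (key z h)
  · exact Or.inr (by simpa using key (-z) h)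

/-! ### Dominance estimates in the two eigenbases -/

section UltrametricPingPong

variable {K : Type*} [NormedField K]

/-- If `c` intertwines `g` with `diag(t, 1, t⁻¹)`, it intertwines `g ^ z` with
`diag(t ^ z, 1, t ^ (-z))`. -/
theorem diag_intertwine_zpow {V : Type*} [AddCommGroup V] [Module K V] {t : K} (ht : t ≠ 0)
    (g : V ≃ₗ[K] V) (c : V → Fin 3 → K)
    (h : ∀ v, c (g v) = ![t * c v 0, c v 1, t⁻¹ * c v 2]) (z : ℤ) (v : V) :
    c ((g ^ z) v) = ![t ^ z * c v 0, c v 1, t ^ (-z) * c v 2] := by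
  induction z using Int.induction_on generalizing v with
  | zero => ext i; fin_cases i <;> simp
  | succ n ih =>
    rw [zpow_add_one, LinearEquiv.mul_apply, ih, h]
    ext i
    fin_cases i <;> simp [zpow_add₀ ht, mul_assoc]
    ring
  | pred n ih =>
    have hv : c v = ![t * c (g⁻¹ v) 0, c (g⁻¹ v) 1, t⁻¹ * c (g⁻¹ v) 2] := by
      rw [← h, ← LinearEquiv.mul_apply, mul_inv_cancel, LinearEquiv.coe_one, id]
    rw [zpow_sub_one, LinearEquiv.mul_apply, ih, hv]
    ext i
    fin_cases i <;> simp [zpow_add₀ ht, zpow_sub₀ ht, mul_assoc] <;> field_simp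

/-- Vectors dominated by their first or last coordinate, with a gap of `‖t‖ ^ 2` for `‖t‖ = 2`. -/
def fDominated (v : Fin 3 → K) : Prop :=
  (0 < ‖v 0‖ ∧ 4 * ‖v 1‖ ≤ ‖v 0‖ ∧ 4 * ‖v 2‖ ≤ ‖v 0‖) ∨
    (0 < ‖v 2‖ ∧ 4 * ‖v 1‖ ≤ ‖v 2‖ ∧ 4 * ‖v 0‖ ≤ ‖v 2‖)

/-- Dominance of the first or last coordinate, with the gaps suited to an eigenbasis of `k`. -/
def kDominated (w : Fin 3 → K) : Prop :=
  (0 < ‖w 0‖ ∧ 2 * ‖w 1‖ ≤ ‖w 0‖ ∧ 2 * ‖w 2‖ ≤ ‖w 0‖) ∨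
    (0 < ‖w 2‖ ∧ 4 * ‖w 1‖ ≤ ‖w 2‖ ∧ 8 * ‖w 0‖ ≤ ‖w 2‖)

/-- Coordinates with respect to an eigenbasis of `k`, up to a scalar. -/
def kCoord (t : K) (v : Fin 3 → K) : Fin 3 → K :=
  ![v 0 + t * v 1 + t * v 2,
    (t ^ 2 + 1) * v 0 + (t ^ 2 + t) * v 1 + (t ^ 2 + 1) * v 2,
    t ^ 2 * v 0 + t ^ 2 * v 1 + t * v 2]

/-- The linear combination of the eigenvectors of `k` with given coefficients. -/
def kComb (t : K) (w : Fin 3 → K) : Fin 3 → K :=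
  ![-t ^ 3 * w 0 + t ^ 2 * w 1 + -t * w 2,
    (t ^ 3 + t) * w 0 + -(t ^ 2 + t) * w 1 + (t ^ 2 + 1) * w 2,
    -t ^ 2 * w 0 + t ^ 2 * w 1 + -t ^ 2 * w 2]

/-- Leaving the scalar in place avoids denominators; dominance does not see it once it is nonzero.
-/
theorem kComb_kCoord (t : K) (v : Fin 3 → K) :
    kComb t (kCoord t v) = ((t - 1) ^ 2 * t ^ 2) • v := by
  ext i
  fin_cases i <;> simp [kComb, kCoord] <;> ring

theorem kCoord_kComb (t : K) (w : Fin 3 → K) :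
    kCoord t (kComb t w) = ((t - 1) ^ 2 * t ^ 2) • w := by
  ext i
  fin_cases i <;> simp [kComb, kCoord] <;> ring

theorem fDominated_smul {s : K} (hs : s ≠ 0) (v : Fin 3 → K) :
    fDominated (s • v) ↔ fDominated v := by
  have h : 0 < ‖s‖ := norm_pos_iff.mpr hs
  simp only [fDominated, Pi.smul_apply, smul_eq_mul, norm_mul, mul_left_comm _ ‖s‖,
    mul_le_mul_iff_right₀ h, mul_pos_iff_of_pos_left h]

theorem kDominated_smul {s : K} (hs : s ≠ 0) (w : Fin 3 → K) :
    kDominated (s • w) ↔ kDominated w := by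
  have h : 0 < ‖s‖ := norm_pos_iff.mpr hs
  simp only [kDominated, Pi.smul_apply, smul_eq_mul, norm_mul, mul_left_comm _ ‖s‖,
    mul_le_mul_iff_right₀ h, mul_pos_iff_of_pos_left h]

variable [IsUltrametricDist K]

theorem norm_add_eq_left_of_lt {x y : K} (h : ‖y‖ < ‖x‖) : ‖x + y‖ = ‖x‖ := by
  rw [IsUltrametricDist.norm_add_eq_max_of_norm_ne_norm h.ne', max_eq_left h.le]

theorem norm_add_three_eq_left {x y z : K} (hy : ‖y‖ < ‖x‖) (hz : ‖z‖ < ‖x‖) :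
    ‖x + y + z‖ = ‖x‖ := by
  have h := norm_add_eq_left_of_lt hy
  rw [norm_add_eq_left_of_lt (h ▸ hz), h]

theorem norm_add_three_eq_right {x y z : K} (hx : ‖x‖ < ‖z‖) (hy : ‖y‖ < ‖z‖) :
    ‖x + y + z‖ = ‖z‖ := by
  rw [show x + y + z = z + x + y by ring, norm_add_three_eq_left hx hy]

variable {t : K}

theorem norm_sq_add_one (ht : ‖t‖ = 2) : ‖t ^ 2 + 1‖ = 4 := by
  rw [norm_add_eq_left_of_lt] <;> simp only [norm_pow, norm_one, ht] <;> norm_num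

theorem norm_sq_add_self (ht : ‖t‖ = 2) : ‖t ^ 2 + t‖ = 4 := by
  rw [norm_add_eq_left_of_lt] <;> simp only [norm_pow, ht] <;> norm_num

theorem norm_cube_add_self (ht : ‖t‖ = 2) : ‖t ^ 3 + t‖ = 8 := by
  rw [norm_add_eq_left_of_lt] <;> simp [ht] <;> norm_num

theorem norm_sub_one_of_norm_eq_two (ht : ‖t‖ = 2) : ‖t - 1‖ = 2 := by
  rw [sub_eq_add_neg, norm_add_eq_left_of_lt] <;> simp [ht]

theorem eigenbasis_scalar_ne_zero (ht : ‖t‖ = 2) : (t - 1) ^ 2 * t ^ 2 ≠ 0 := by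
  rw [← norm_ne_zero_iff]
  simp [ht, norm_sub_one_of_norm_eq_two ht]

theorem norm_kCoord_of_fst {v : Fin 3 → K} (ht : ‖t‖ = 2) (h0 : 0 < ‖v 0‖)
    (h1 : 4 * ‖v 1‖ ≤ ‖v 0‖) (h2 : 4 * ‖v 2‖ ≤ ‖v 0‖) :
    ‖kCoord t v 0‖ = ‖v 0‖ ∧ ‖kCoord t v 1‖ = 4 * ‖v 0‖ ∧ ‖kCoord t v 2‖ = 4 * ‖v 0‖ := by
  refine ⟨?_, ?_, ?_⟩ <;> simp only [kCoord, Matrix.cons_val] <;>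
    rw [norm_add_three_eq_left] <;>
    simp only [norm_mul, norm_pow, norm_sq_add_one ht, norm_sq_add_self ht, ht] <;> linarith

theorem norm_kCoord_of_last {v : Fin 3 → K} (ht : ‖t‖ = 2) (h0 : 0 < ‖v 2‖)
    (h1 : 4 * ‖v 1‖ ≤ ‖v 2‖) (h2 : 4 * ‖v 0‖ ≤ ‖v 2‖) :
    ‖kCoord t v 0‖ = 2 * ‖v 2‖ ∧ ‖kCoord t v 1‖ = 4 * ‖v 2‖ ∧ ‖kCoord t v 2‖ = 2 * ‖v 2‖ := by
  refine ⟨?_, ?_, ?_⟩ <;> simp only [kCoord, Matrix.cons_val] <;>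
    rw [norm_add_three_eq_right] <;>
    simp only [norm_mul, norm_pow, norm_sq_add_one ht, norm_sq_add_self ht, ht] <;> linarith

theorem norm_kComb_of_fst {w : Fin 3 → K} (ht : ‖t‖ = 2) (h0 : 0 < ‖w 0‖)
    (h1 : 2 * ‖w 1‖ ≤ ‖w 0‖) (h2 : 2 * ‖w 2‖ ≤ ‖w 0‖) :
    ‖kComb t w 0‖ = 8 * ‖w 0‖ ∧ ‖kComb t w 1‖ = 8 * ‖w 0‖ ∧ ‖kComb t w 2‖ = 4 * ‖w 0‖ := by
  refine ⟨?_, ?_, ?_⟩ <;> simp only [kComb, Matrix.cons_val] <;>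
    rw [norm_add_three_eq_left] <;>
    simp only [norm_mul, norm_neg, norm_pow, norm_sq_add_one ht, norm_sq_add_self ht,
      norm_cube_add_self ht, ht] <;> linarith

/-- Coordinate 0 dictates the gaps 4 and 8: there `w 2` carries only `t`, against `t ^ 2` for `w 1`
and `t ^ 3` for `w 0`. -/
theorem norm_kComb_of_last {w : Fin 3 → K} (ht : ‖t‖ = 2) (h0 : 0 < ‖w 2‖)
    (h1 : 4 * ‖w 1‖ ≤ ‖w 2‖) (h2 : 8 * ‖w 0‖ ≤ ‖w 2‖) :
    ‖kComb t w 0‖ = 2 * ‖w 2‖ ∧ ‖kComb t w 1‖ = 4 * ‖w 2‖ ∧ ‖kComb t w 2‖ = 4 * ‖w 2‖ := by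
  refine ⟨?_, ?_, ?_⟩ <;> simp only [kComb, Matrix.cons_val] <;>
    rw [norm_add_three_eq_right] <;>
    simp only [norm_mul, norm_neg, norm_pow, norm_sq_add_one ht, norm_sq_add_self ht,
      norm_cube_add_self ht, ht] <;> linarith

/-- The middle eigencoordinate attains the maximal norm, so no outer one can dominate it. -/
theorem not_kDominated_of_fDominated (ht : ‖t‖ = 2) {v : Fin 3 → K} (hv : fDominated v) :
    ¬ kDominated (kCoord t v) := by
  rcases hv with ⟨h0, h1, h2⟩ | ⟨h0, h1, h2⟩
  · obtain ⟨e0, e1, e2⟩ := norm_kCoord_of_fst ht h0 h1 h2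
    rintro (⟨-, d1, d2⟩ | ⟨-, d1, d2⟩) <;> rw [e0, e1, e2] at * <;> linarith
  · obtain ⟨e0, e1, e2⟩ := norm_kCoord_of_last ht h0 h1 h2
    rintro (⟨-, d1, d2⟩ | ⟨-, d1, d2⟩) <;> linarith

theorem kDominated_diag_zpow_kCoord (ht : ‖t‖ = 2) {v : Fin 3 → K} (hv : fDominated v) {z : ℤ}
    (hz : 3 ≤ |z|) :
    kDominated ![t ^ z * kCoord t v 0, kCoord t v 1, t ^ (-z) * kCoord t v 2] := by
  simp only [kDominated, Matrix.cons_val, norm_mul, norm_zpow, ht]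
  rcases hv with ⟨h0, h1, h2⟩ | ⟨h0, h1, h2⟩
  · obtain ⟨e0, e1, e2⟩ := norm_kCoord_of_fst ht h0 h1 h2
    rw [e0, e1, e2]
    rcases two_zpow_bounds hz with ⟨b, p, s⟩ | ⟨b, p, s⟩
    -- The factor 8 is sharp: the norms 1, 4, 4 must yield a gap of 2 over the middle one.
    · refine Or.inl ⟨by positivity, ?_, ?_⟩ <;> nlinarith
    · refine Or.inr ⟨by positivity, ?_, ?_⟩ <;> nlinarith
  · obtain ⟨e0, e1, e2⟩ := norm_kCoord_of_last ht h0 h1 h2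
    rw [e0, e1, e2]
    rcases two_zpow_bounds hz with ⟨b, p, s⟩ | ⟨b, p, s⟩
    · refine Or.inl ⟨by positivity, ?_, ?_⟩ <;> nlinarith
    · refine Or.inr ⟨by positivity, ?_, ?_⟩ <;> nlinarith

theorem fDominated_diag_zpow_kComb (ht : ‖t‖ = 2) {w : Fin 3 → K} (hw : kDominated w) {z : ℤ}
    (hz : 3 ≤ |z|) :
    fDominated ![t ^ z * kComb t w 0, kComb t w 1, t ^ (-z) * kComb t w 2] := by
  simp only [fDominated, Matrix.cons_val, norm_mul, norm_zpow, ht]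
  rcases hw with ⟨h0, h1, h2⟩ | ⟨h0, h1, h2⟩
  · obtain ⟨e0, e1, e2⟩ := norm_kComb_of_fst ht h0 h1 h2
    rw [e0, e1, e2]
    rcases two_zpow_bounds hz with ⟨b, p, s⟩ | ⟨b, p, s⟩
    · refine Or.inl ⟨by positivity, ?_, ?_⟩ <;> nlinarith
    · refine Or.inr ⟨by positivity, ?_, ?_⟩ <;> nlinarith
  · obtain ⟨e0, e1, e2⟩ := norm_kComb_of_last ht h0 h1 h2
    rw [e0, e1, e2]
    rcases two_zpow_bounds hz with ⟨b, p, s⟩ | ⟨b, p, s⟩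
    · refine Or.inl ⟨by positivity, ?_, ?_⟩ <;> nlinarith
    · refine Or.inr ⟨by positivity, ?_, ?_⟩ <;> nlinarith

end UltrametricPingPong

/-- The action of `SL₃(ℤ[t, t⁻¹])` on `K ^ 3` obtained by specializing `t` to a unit of `K`. -/
noncomputable def specializeSL {K : Type*} [Field K] (u : Kˣ) :
    Matrix.SpecialLinearGroup (Fin 3) ℤ[T;T⁻¹] →* (Fin 3 → K) ≃ₗ[K] (Fin 3 → K) :=
  Matrix.SpecialLinearGroup.toLin'.comp
    (Matrix.SpecialLinearGroup.map (LaurentPolynomial.eval₂ (Int.castRingHom K) u))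

theorem specializeSL_burauF {K : Type*} [Field K] (u : Kˣ) (v : Fin 3 → K) :
    specializeSL u burauF v = ![u * v 0, v 1, (u : K)⁻¹ * v 2] := by
  change ((burauFMatrix.map (LaurentPolynomial.eval₂ (Int.castRingHom K) u)).mulVec v) = _
  ext i
  fin_cases i <;> simp [burauFMatrix, Matrix.mulVec, dotProduct, Fin.sum_univ_three]

theorem kCoord_specializeSL_burauK {K : Type*} [NormedField K] (u : Kˣ) (v : Fin 3 → K) :
    kCoord (u : K) (specializeSL u burauK v) =
      ![u * kCoord (u : K) v 0, kCoord (u : K) v 1, (u : K)⁻¹ * kCoord (u : K) v 2] := by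
  have hu : (u : K) ≠ 0 := u.ne_zero
  have hk : specializeSL u burauK v =
      ![(-1 - u) * v 1 + (-(u : K)⁻¹ - 1 - u) * v 2,
        ((u : K)⁻¹ + 1 + u) * v 1 + (((u : K) ^ 2)⁻¹ + (u : K)⁻¹ + 1 + u) * v 2,
        v 0] := by
    change ((burauKMatrix.map (LaurentPolynomial.eval₂ (Int.castRingHom K) u)).mulVec v) = _
    ext i
    fin_cases i <;>
      simp [burauKMatrix, Matrix.mulVec, dotProduct, Fin.sum_univ_three, zpow_neg]
  rw [hk]
  ext i
  fin_cases i <;> simp [kCoord] <;> field_simp <;> ring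

theorem injective_lift_burau_pow {K : Type*} [NormedField K] [IsUltrametricDist K] (u : Kˣ)
    (hu : ‖(u : K)‖ = 2) {m n : ℕ} (hm : 3 ≤ m) (hn : 3 ≤ n) :
    Function.Injective
      (FreeGroup.lift ![specializeSL u burauF ^ m, specializeSL u burauK ^ n]) := by
  have hs := eigenbasis_scalar_ne_zero hu
  have habs : ∀ {l : ℕ} {z : ℤ}, 3 ≤ l → z ≠ 0 → 3 ≤ |(l : ℤ) * z| := by
    intro l z hl hz
    have h1 : 1 ≤ |z| := Int.one_le_abs hz
    rw [abs_mul, Nat.abs_cast]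
    nlinarith
  have hdisj : Disjoint {v : Fin 3 → K | fDominated v} {v | kDominated (kCoord (u : K) v)} :=
    Set.disjoint_left.mpr fun v hv => not_kDominated_of_fDominated hu hv
  refine FreeGroup.injective_lift_of_zpow_ping_pong _
    ![{v | fDominated v}, {v | kDominated (kCoord (u : K) v)}] ?_ ?_ ?_
  · intro i
    fin_cases i
    · exact ⟨![1, 0, 0], by simp [fDominated]⟩
    · refine ⟨kComb (u : K) ![1, 0, 0], ?_⟩
      change kDominated (kCoord (u : K) (kComb (u : K) ![1, 0, 0]))
      rw [kCoord_kComb, kDominated_smul hs]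
      simp [kDominated]
  · intro i j hij
    fin_cases i <;> fin_cases j
    · exact absurd rfl hij
    · exact hdisj
    · exact hdisj.symm
    · exact absurd rfl hij
  · intro i j hij z hz v hv
    fin_cases i <;> fin_cases j
    · exact absurd rfl hij
    · change fDominated (((specializeSL u burauF ^ m) ^ z) v)
      have h := fDominated_diag_zpow_kComb hu hv (habs hm hz)
      rw [kComb_kCoord] at h
      have hpow := diag_intertwine_zpow u.ne_zero _ id (specializeSL_burauF u) (m * z)
      simp only [id] at hpow
      rw [← zpow_natCast, ← zpow_mul, ← fDominated_smul hs, ← map_smul, hpow]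
      exact h
    · change kDominated (kCoord (u : K) (((specializeSL u burauK ^ n) ^ z) v))
      rw [← zpow_natCast, ← zpow_mul,
        diag_intertwine_zpow u.ne_zero _ _ (kCoord_specializeSL_burauK u)]
      exact kDominated_diag_zpow_kCoord hu hv (habs hn hz)
    · exact absurd rfl hij

/-- For `m, n ≥ 3` the subgroup of `SL₃(ℤ[t, t⁻¹])` generated by `f ^ m` and `k ^ n` is free of
rank two, with free basis `(f ^ m, k ^ n)`. -/
theorem mainTheorem1 (m n : ℕ) (hm : 3 ≤ m) (hn : 3 ≤ n) :
    ∃ b : FreeGroupBasis (Fin 2) (Subgroup.closure {burauF ^ m, burauK ^ n}),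
      (b 0 : Matrix.SpecialLinearGroup (Fin 3) (LaurentPolynomial ℤ)) = burauF ^ m ∧
      (b 1 : Matrix.SpecialLinearGroup (Fin 3) (LaurentPolynomial ℤ)) = burauK ^ n := by
  -- The specialization is `t = 1/2` in the 2-adic numbers, of norm exactly 2.
  have h2 : (2 : ℚ_[2])⁻¹ ≠ 0 := by norm_num
  have hnorm : ‖((Units.mk0 _ h2 : ℚ_[2]ˣ) : ℚ_[2])‖ = 2 := by
    simpa using congrArg (·⁻¹) (Padic.norm_p (p := 2))
  have hinj : Function.Injective (FreeGroup.lift ![burauF ^ m, burauK ^ n]) := by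
    refine Function.Injective.of_comp (f := specializeSL (Units.mk0 _ h2)) ?_
    have hcomp : (specializeSL (Units.mk0 _ h2)).comp (FreeGroup.lift ![burauF ^ m, burauK ^ n]) =
        FreeGroup.lift ![specializeSL (Units.mk0 _ h2) burauF ^ m,
          specializeSL (Units.mk0 _ h2) burauK ^ n] := by
      ext i : 1
      fin_cases i <;> simp
    rw [← MonoidHom.coe_comp, hcomp]
    exact injective_lift_burau_pow _ hnorm hm hn
  have hb := FreeGroupBasis.exists_closure_range _ hinj
  rw [Matrix.range_cons_cons_empty] at hb
  obtain ⟨b, hb⟩ := hb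
  exact ⟨b, hb 0, hb 1⟩
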